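/- **Theorem.** Work in the ring $\mathbb{Z}[[q]]$ of formal power series, with coefficientwise convergence. For formal power series $a,b$ with zero constant coefficient put $(a;b)_n=\prod_{t=0}^{n-1}(1-ab^t)$ for $n\ge 0$, $(a;b)_\infty=\prod_{t\ge 0}(1-ab^t)$, and $(a_1,\dots,a_m;b)_\infty=(a_1;b)_\infty\cdots(a_m;b)_\infty$. Then all the sums below converge, and the following identities hold: $$\sum_{i,j\ge 0}\frac{q^{2i^2+6ij+6j^2}}{(q;q)_i\,(q^3;q^3)_j}=\frac{1}{(q^2,q^3,q^9,q^{10};q^{12})_\infty},$$ and $$\sum_{i,j,k,l\ge 0}\frac{q^{\frac{3(i+j+k+2l)(i+j+k+2l-1)}{2}+3i+5j+\frac{3j(j-1)}{2}+k+\frac{3k(k-1)}{2}+3l}}{(q^3;q^3)_i\,(q^3;q^3)_j\,(q^3;q^3)_k\,(q^6;q^6)_l} =\sum_{i,j\ge 0}\frac{q^{2i^2+6ij+6j^2+i}}{(q;q)_i\,(q^3;q^3)_j}+\sum_{i,j\ge 0}\frac{q^{2i^2+6ij+6j^2+4i+6j+1}}{(q;q)_i\,(q^3;q^3)_j} =(-q,-q^3,-q^5,-q^6;q^6)_\infty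 .$$ -/

import Mathlib

open PowerSeries

open scoped PowerSeries.WithPiTopology

/-! Formal power series in `q = X` over `ℤ`. Since `ℤ` is discrete, the product topology on `ℤ⟦X⟧` is
the usual topology of formal power series: each coefficient is eventually constant. -/

/-- The finite `q`-Pochhammer symbol `(a; q)_n = (1 - a)(1 - a q) ⋯ (1 - a q ^ (n - 1))`. -/
noncomputable def qPoch (a q : ℤ⟦X⟧) (n : ℕ) : ℤ⟦X⟧ :=
  ∏ t ∈ Finset.range n, (1 - a * q ^ t)

/-- The infinite `q`-Pochhammer symbol `(a; q)_∞ = ∏_{t ≥ 0} (1 - a q ^ t)`. The product converges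
as soon as `q` has zero constant coefficient, see `multipliable_qPochInf`. -/
noncomputable def qPochInf (a q : ℤ⟦X⟧) : ℤ⟦X⟧ :=
  ∏' t : ℕ, (1 - a * q ^ t)

/-- `(a₁, …, aₘ; q)_∞ = (a₁; q)_∞ ⋯ (aₘ; q)_∞`. -/
noncomputable def qPochInfList (as : List ℤ⟦X⟧) (q : ℤ⟦X⟧) : ℤ⟦X⟧ :=
  (as.map fun a => qPochInf a q).prod

/-- The quotient `f / g` of formal power series, for `g` invertible in `ℤ⟦X⟧`. All denominators
used below are invertible, see `isUnit_qPoch` and `isUnit_qPochInfList`. -/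
noncomputable def psDiv (f g : ℤ⟦X⟧) : ℤ⟦X⟧ :=
  f * Ring.inverse g

theorem multipliable_qPochInf (a q : ℤ⟦X⟧) (hq : constantCoeff q = 0) :
    Multipliable fun t : ℕ => 1 - a * q ^ t := by
  simp_rw [sub_eq_add_neg]
  apply PowerSeries.WithPiTopology.multipliable_one_add_of_tendsto_order_atTop_nhds_top
  refine ENat.tendsto_nhds_top_iff_natCast_lt.mpr
    (fun n => Filter.eventually_atTop.mpr ⟨n + 1, fun m hm => ?_⟩)
  have h1 : (X : ℤ⟦X⟧) ^ m ∣ -(a * q ^ m) :=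
    (dvd_neg).mpr (Dvd.dvd.mul_left (pow_dvd_pow_of_dvd (X_dvd_iff.mpr hq) m) a)
  have h2 := X_pow_dvd_iff.mp h1
  have h3 : (m : ℕ∞) ≤ (-(a * q ^ m)).order := nat_le_order _ _ h2
  exact lt_of_lt_of_le (by exact_mod_cast hm) h3

theorem isUnit_qPoch (a q : ℤ⟦X⟧) (ha : constantCoeff a = 0) (n : ℕ) : IsUnit (qPoch a q n) := by
  rw [isUnit_iff_constantCoeff, qPoch, map_prod]
  simp [ha]

theorem isUnit_qPochInf (a q : ℤ⟦X⟧) (ha : constantCoeff a = 0) (hq : constantCoeff q = 0) :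
    IsUnit (qPochInf a q) := by
  rw [isUnit_iff_constantCoeff, qPochInf, (multipliable_qPochInf a q hq).map_tprod _
    (PowerSeries.WithPiTopology.continuous_constantCoeff ℤ)]
  simp [ha]

theorem isUnit_qPochInfList (as : List ℤ⟦X⟧) (q : ℤ⟦X⟧) (ha : ∀ a ∈ as, constantCoeff a = 0)
    (hq : constantCoeff q = 0) : IsUnit (qPochInfList as q) := by
  induction as with
  | nil => simp [qPochInfList]
  | cons a as ih =>
    have h : qPochInfList (a :: as) q = qPochInf a q * qPochInfList as q := by
      simp [qPochInfList]
    rw [h]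
    exact (isUnit_qPochInf a q (ha a (by simp)) hq).mul
      (ih fun b hb => ha b (List.mem_cons_of_mem a hb))

/-- The summand `q ^ (2 i² + 6 i j + 6 j²) / ((q; q)_i (q³; q³)_j)`, for `p = (i, j)`. -/
noncomputable def cap1Term (p : ℕ × ℕ) : ℤ⟦X⟧ :=
  psDiv (X ^ (2 * p.1 ^ 2 + 6 * p.1 * p.2 + 6 * p.2 ^ 2))
    (qPoch X X p.1 * qPoch (X ^ 3) (X ^ 3) p.2)

/-- The summand `q ^ (2 i² + 6 i j + 6 j² + i) / ((q; q)_i (q³; q³)_j)`, for `p = (i, j)`. -/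
noncomputable def cap2TermA (p : ℕ × ℕ) : ℤ⟦X⟧ :=
  psDiv (X ^ (2 * p.1 ^ 2 + 6 * p.1 * p.2 + 6 * p.2 ^ 2 + p.1))
    (qPoch X X p.1 * qPoch (X ^ 3) (X ^ 3) p.2)

/-- The summand `q ^ (2 i² + 6 i j + 6 j² + 4 i + 6 j + 1) / ((q; q)_i (q³; q³)_j)`,
for `p = (i, j)`. -/
noncomputable def cap2TermB (p : ℕ × ℕ) : ℤ⟦X⟧ :=
  psDiv (X ^ (2 * p.1 ^ 2 + 6 * p.1 * p.2 + 6 * p.2 ^ 2 + 4 * p.1 + 6 * p.2 + 1))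
    (qPoch X X p.1 * qPoch (X ^ 3) (X ^ 3) p.2)

/-- The exponent `3 m (m - 1) / 2 + 3 i + 5 j + 3 j (j - 1) / 2 + k + 3 k (k - 1) / 2 + 3 l` with
`m = i + j + k + 2 l`. All divisions are exact, and the truncated differences are harmless since
`n * (n - 1) = 0` for `n = 0`. -/
def cap2Exponent (i j k l : ℕ) : ℕ :=
  3 * (i + j + k + 2 * l) * (i + j + k + 2 * l - 1) / 2 + 3 * i + 5 * j + 3 * j * (j - 1) / 2
    + k + 3 * k * (k - 1) / 2 + 3 * l

/-- The summand of the fourfold sum, for `p = (i, j, k, l)`. -/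
noncomputable def cap2TermFour (p : ℕ × ℕ × ℕ × ℕ) : ℤ⟦X⟧ :=
  psDiv (X ^ cap2Exponent p.1 p.2.1 p.2.2.1 p.2.2.2)
    (qPoch (X ^ 3) (X ^ 3) p.1 * qPoch (X ^ 3) (X ^ 3) p.2.1 *
      qPoch (X ^ 3) (X ^ 3) p.2.2.1 * qPoch (X ^ 6) (X ^ 6) p.2.2.2)

/-!
Adjoin an outer variable `z` and let `L(∑ aₙ zⁿ) = ∑ b ^ (n (n - 1) / 2) aₙ`, where `b = q³`. By
Euler's expansions of `1 / (z; b)_∞` and `(-z; b)_∞`, every sum in the theorem is the image under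
`L` of a product of such series. The products behind the double sums split over the base `b`, which
identifies the first one with

  `(1 / (b z; b)_∞) W(z)`,  `W(z) = (-α z; b)_∞ (-β z; b)_∞ / (b z²; b²)_∞`,  `α β = b²`,

for `(α, β) = (q², q⁴)`. Since `L(z F(z)) = L(F(b z))`, the sum of the two double sums of the second
identity is `L` of a single product with an additional factor `1 + q z`, and this is the same
expression for `(α, β) = (q⁵, q)`, which visibly gives the fourfold sum.

It remains to evaluate `L` on it. The substitution `z ↦ b z` yields a three-term recurrence for the
coefficients of `W`. Thanks to `α β = b²` it is solved by `b ^ (n (n - 1) / 2) wₙ = (-b; b)_n eₙ`,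
where `eₙ` are the coefficients of `(-α z, -β z; b²)_∞`. As `L(zⁿ / (b z; b)_∞)` equals
`b ^ (n (n - 1) / 2) (-b ^ (n + 1); b)_∞`, the result is
`(-b; b)_∞ ∑ eₙ = (-b; b)_∞ (-α, -β; b²)_∞`.
-/

open Filter Topology

section PowerSeriesTopology

theorem tendsto_rescale_pow {R : Type*} [CommSemiring R] [TopologicalSpace R] [ContinuousMul R]
    {b : R} (hb : IsTopologicallyNilpotent b) (F : R⟦X⟧) :
    Tendsto (fun n => rescale (b ^ n) F) atTop (𝓝 (C (constantCoeff F))) := by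
  rw [WithPiTopology.tendsto_iff_coeff_tendsto]
  rintro (_ | d)
  · simpa using tendsto_const_nhds
  · have h : Tendsto (fun n => (b ^ n) ^ (d + 1) * coeff (d + 1) F) atTop (𝓝 0) := by
      simpa using (hb.pow (d + 1)).mul_const (coeff (d + 1) F)
    simpa [coeff_C] using h

variable {R : Type*} [CommRing R] [TopologicalSpace R]

theorem continuous_expand {p : ℕ} (hp : p ≠ 0) : Continuous (expand (R := R) p hp) := by
  refine continuous_iff_continuousAt.mpr fun F => ?_
  rw [ContinuousAt, WithPiTopology.tendsto_iff_coeff_tendsto]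
  intro d
  simp only [coeff_expand]
  split_ifs
  · exact (WithPiTopology.continuous_coeff R _).continuousAt
  · exact tendsto_const_nhds

theorem hasSum_monomial_expand {p : ℕ} (hp : p ≠ 0) (F : R⟦X⟧) :
    HasSum (fun n => monomial (p * n) (coeff n F)) (expand p hp F) := by
  simpa only [Function.comp_def, expand_monomial] using
    (hasSum_of_monomials_self F).map (expand p hp) (continuous_expand hp)

variable [IsTopologicalRing R] [IsLinearTopology R R]

theorem hasSum_mul_of_isLinearTopology {ι κ : Type*} {f : ι → R} {g : κ → R} {a b : R}
    (hf : HasSum f a) (hg : HasSum g b) : HasSum (fun p : ι × κ => f p.1 * g p.2) (a * b) := by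
  let _ := IsTopologicalAddGroup.rightUniformSpace R
  have := isUniformAddGroup_of_addCommGroup (G := R)
  have : NonarchimedeanRing R :=
    { is_nonarchimedean := fun U hU => by
        obtain ⟨I, hI, hIU⟩ := IsLinearTopology.hasBasis_ideal.mem_iff.mp hU
        exact ⟨⟨I.toAddSubgroup, I.toAddSubgroup.isOpen_of_mem_nhds hI⟩, hIU⟩ }
  exact hf.mul_of_nonarchimedean hg

theorem hasSum_coeff_mul [T3Space R] {F G : R⟦X⟧} {a b : R}
    (hF : HasSum (fun n => coeff n F) a) (hG : HasSum (fun n => coeff n G) b) :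
    HasSum (fun n => coeff n (F * G)) (a * b) := by
  have h := hasSum_mul_of_isLinearTopology hF hG
  have hsigma := (Equiv.hasSum_iff Finset.HasAntidiagonal.sigmaAntidiagonalEquivProd).mpr h
  refine hsigma.sigma fun n => ?_
  rw [coeff_mul, ← Finset.sum_coe_sort]
  exact hasSum_fintype _

theorem hasSum_monomial_mul {ι κ : Type*} {w : ι → ℕ} {w' : κ → ℕ} {c : ι → R} {c' : κ → R}
    {F G : R⟦X⟧} (hF : HasSum (fun p => monomial (w p) (c p)) F)
    (hG : HasSum (fun p => monomial (w' p) (c' p)) G) :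
    HasSum (fun p : ι × κ => monomial (w p.1 + w' p.2) (c p.1 * c' p.2)) (F * G) := by
  simpa only [monomial_mul_monomial] using hasSum_mul_of_isLinearTopology hF hG

end PowerSeriesTopology

section Rescale

variable {R : Type*}

@[simp]
theorem constantCoeff_rescale [CommSemiring R] (b : R) (F : R⟦X⟧) :
    constantCoeff (rescale b F) = constantCoeff F := by
  simp only [← coeff_zero_eq_constantCoeff_apply, coeff_rescale, pow_zero, one_mul]

theorem rescale_expand [CommRing R] {p : ℕ} (hp : p ≠ 0) (b : R) (F : R⟦X⟧) :
    rescale b (expand p hp F) = expand p hp (rescale (b ^ p) F) := by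
  ext n
  rw [coeff_rescale, coeff_expand, coeff_expand]
  split_ifs with h
  · rw [coeff_rescale, ← pow_mul, Nat.mul_div_cancel' h]
  · rw [mul_zero]

theorem eq_of_mul_rescale_eq [CommRing R] [IsDomain R] {b : R} (hb : ∀ n, b ^ (n + 1) ≠ 1)
    {u v F G : R⟦X⟧} (hu : constantCoeff u = 1) (hv : constantCoeff v = 1)
    (hF : u * rescale b F = v * F) (hG : u * rescale b G = v * G)
    (h0 : constantCoeff F = constantCoeff G) : F = G := by
  by_contra hne
  have hD : F - G ≠ 0 := sub_ne_zero.mpr hne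
  set H := (F - G).divXPowOrder with hH
  set n := (F - G).order.toNat
  have hFG : X ^ n * H = F - G := X_pow_order_mul_divXPowOrder
  have hH0 : constantCoeff H ≠ 0 := by rwa [Ne, hH, constantCoeff_divXPowOrder_eq_zero_iff]
  have hn0 : n ≠ 0 := by
    intro hn0
    rw [hn0, pow_zero, one_mul] at hFG
    exact hH0 (by rw [hFG, map_sub, h0, sub_self])
  have hrec : u * (C (b ^ n) * rescale b H) = v * H := by
    refine mul_left_cancel₀ (pow_ne_zero n X_ne_zero) ?_
    have h := congrArg (rescale b) hFG
    simp only [map_mul, map_pow, rescale_X, map_sub, mul_pow] at h ⊢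
    linear_combination u * h + hF - hG - v * hFG
  have hlead : b ^ n * constantCoeff H = constantCoeff H := by
    simpa [hu, hv] using congrArg constantCoeff hrec
  obtain ⟨m, hm⟩ := Nat.exists_eq_succ_of_ne_zero hn0
  exact hb m (mul_right_cancel₀ hH0 (by rw [← Nat.succ_eq_add_one, ← hm, hlead, one_mul]))

end Rescale

section Pochhammer

theorem qPoch_succ (a q : ℤ⟦X⟧) (n : ℕ) : qPoch a q (n + 1) = qPoch a q n * (1 - a * q ^ n) :=
  Finset.prod_range_succ _ _

variable {q : ℤ⟦X⟧}

theorem tendsto_qPoch (hq : constantCoeff q = 0) (a : ℤ⟦X⟧) :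
    Tendsto (qPoch a q) atTop (𝓝 (qPochInf a q)) :=
  (multipliable_qPochInf a q hq).hasProd.tendsto_prod_nat

theorem qPochInf_eq_qPoch_mul (hq : constantCoeff q = 0) (a : ℤ⟦X⟧) (n : ℕ) :
    qPochInf a q = qPoch a q n * qPochInf (a * q ^ n) q := by
  have h : (fun t => 1 - a * q ^ n * q ^ t) = fun t => 1 - a * q ^ (t + n) := by
    ext1 t
    ring
  have hm := h ▸ multipliable_qPochInf (a * q ^ n) q hq
  rw [qPochInf, qPochInf, qPoch, h]
  exact (hm.prod_mul_tprod_nat_mul').symm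

theorem qPochInf_mul_qPochInf_neg (hq : constantCoeff q = 0) (a : ℤ⟦X⟧) :
    qPochInf a q * qPochInf (-a) q = qPochInf (a ^ 2) (q ^ 2) := by
  simp only [qPochInf]
  rw [← (multipliable_qPochInf a q hq).tprod_mul (multipliable_qPochInf (-a) q hq)]
  exact tprod_congr fun t => by ring

theorem qPochInf_mul_qPochInf_sq (hq : constantCoeff q = 0) (a : ℤ⟦X⟧) :
    qPochInf a (q ^ 2) * qPochInf (a * q) (q ^ 2) = qPochInf a q := by
  have hq2 : constantCoeff (q ^ 2) = 0 := by simp [hq]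
  have heven (t : ℕ) : 1 - a * (q ^ 2) ^ t = 1 - a * q ^ (2 * t) := by ring
  have hodd (t : ℕ) : 1 - a * q * (q ^ 2) ^ t = 1 - a * q ^ (2 * t + 1) := by ring
  have h₁ := multipliable_qPochInf a (q ^ 2) hq2
  have h₂ := multipliable_qPochInf (a * q) (q ^ 2) hq2
  simp only [heven] at h₁
  simp only [hodd] at h₂
  simp only [qPochInf, heven, hodd]
  exact tprod_even_mul_odd (f := fun t => 1 - a * q ^ t) h₁ h₂

theorem qPochInf_neg_mul (hq : constantCoeff q = 0) (a : ℤ⟦X⟧) :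
    qPochInf (-a) q * (qPochInf a (q ^ 2) * qPochInf (a * q) (q ^ 2)) =
      qPochInf (a ^ 2) (q ^ 2) := by
  rw [qPochInf_mul_qPochInf_sq hq, mul_comm, qPochInf_mul_qPochInf_neg hq]

end Pochhammer

section QExponential

/-- The series `∑ zⁿ / (b; b)_n = 1 / (z; b)_∞` in the outer variable `z`, the small
`b`-exponential. Its coefficients are meaningful only when `b` has zero constant coefficient. -/
noncomputable def smallQExp (b : ℤ⟦X⟧) : ℤ⟦X⟧⟦X⟧ :=
  PowerSeries.mk fun n => psDiv 1 (qPoch b b n)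

/-- The series `∑ b ^ (n (n - 1) / 2) zⁿ / (b; b)_n = (-z; b)_∞` in the outer variable `z`, the big
`b`-exponential. Its coefficients are meaningful only when `b` has zero constant coefficient. -/
noncomputable def bigQExp (b : ℤ⟦X⟧) : ℤ⟦X⟧⟦X⟧ :=
  PowerSeries.mk fun n => psDiv (b ^ n.choose 2) (qPoch b b n)

theorem psDiv_mul_psDiv (f g h k : ℤ⟦X⟧) : psDiv f g * psDiv h k = psDiv (f * h) (g * k) := by
  rw [psDiv, psDiv, psDiv, Ring.mul_inverse_rev]
  ring

theorem mul_psDiv (f g h : ℤ⟦X⟧) : f * psDiv g h = psDiv (f * g) h :=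
  (mul_assoc f g _).symm

theorem psDiv_mul_self (f : ℤ⟦X⟧) {g : ℤ⟦X⟧} (hg : IsUnit g) : psDiv f g * g = f := by
  rw [psDiv, mul_assoc, Ring.inverse_mul_cancel g hg, mul_one]

@[simp]
theorem psDiv_qPoch_zero (f b : ℤ⟦X⟧) : psDiv f (qPoch b b 0) = f := by
  simp [psDiv, qPoch]

variable {b : ℤ⟦X⟧}

theorem one_sub_mul_psDiv_qPoch_succ (hb : constantCoeff b = 0) (f : ℤ⟦X⟧) (n : ℕ) :
    (1 - b ^ (n + 1)) * psDiv f (qPoch b b (n + 1)) = psDiv f (qPoch b b n) := by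
  refine (isUnit_qPoch b b hb n).mul_right_cancel ?_
  rw [psDiv_mul_self f (isUnit_qPoch b b hb n)]
  have h := psDiv_mul_self f (isUnit_qPoch b b hb (n + 1))
  rw [qPoch_succ] at h ⊢
  linear_combination h

theorem pow_succ_ne_one (hb : constantCoeff b = 0) (n : ℕ) : b ^ (n + 1) ≠ 1 :=
  fun h => by simpa [hb] using congrArg constantCoeff h

@[simp]
theorem constantCoeff_smallQExp (b : ℤ⟦X⟧) : constantCoeff (smallQExp b) = 1 := by
  simp [smallQExp, ← coeff_zero_eq_constantCoeff_apply]

@[simp]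
theorem constantCoeff_bigQExp (b : ℤ⟦X⟧) : constantCoeff (bigQExp b) = 1 := by
  simp [bigQExp, ← coeff_zero_eq_constantCoeff_apply]

theorem coeff_bigQExp (b : ℤ⟦X⟧) (n : ℕ) :
    coeff n (bigQExp b) = b ^ n.choose 2 * coeff n (smallQExp b) := by
  simp only [bigQExp, smallQExp, coeff_mk, mul_psDiv, mul_one]

theorem coeff_rescale_smallQExp (b c : ℤ⟦X⟧) (n : ℕ) :
    coeff n (rescale c (smallQExp b)) = psDiv (c ^ n) (qPoch b b n) := by
  rw [coeff_rescale, smallQExp, coeff_mk, mul_psDiv, mul_one]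

theorem coeff_rescale_bigQExp (b c : ℤ⟦X⟧) (n : ℕ) :
    coeff n (rescale c (bigQExp b)) = psDiv (c ^ n * b ^ n.choose 2) (qPoch b b n) := by
  rw [coeff_rescale, bigQExp, coeff_mk, mul_psDiv]

theorem rescale_smallQExp (hb : constantCoeff b = 0) :
    rescale b (smallQExp b) = (1 - X) * smallQExp b := by
  ext1 n
  rcases n with _ | n
  · simp
  · rw [sub_mul, one_mul, map_sub, coeff_succ_X_mul, coeff_rescale, smallQExp, coeff_mk, coeff_mk]
    linear_combination -one_sub_mul_psDiv_qPoch_succ hb 1 n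

theorem bigQExp_eq_mul_rescale (hb : constantCoeff b = 0) :
    bigQExp b = (1 + X) * rescale b (bigQExp b) := by
  ext1 n
  rcases n with _ | n
  · simp
  · rw [add_mul, one_mul, map_add, coeff_succ_X_mul, coeff_rescale, coeff_rescale, coeff_bigQExp,
      coeff_bigQExp, Nat.choose_succ_succ' n 1, Nat.choose_one_right, smallQExp, coeff_mk, coeff_mk]
    linear_combination b ^ (n + n.choose 2) * one_sub_mul_psDiv_qPoch_succ hb 1 n

theorem rescale_bigQExp (hb : constantCoeff b = 0) (c : ℤ⟦X⟧) :
    rescale c (bigQExp b) = (1 + C c * X) * rescale (c * b) (bigQExp b) := by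
  conv_lhs => rw [bigQExp_eq_mul_rescale hb]
  rw [map_mul, map_add, map_one, rescale_X, rescale_rescale, mul_comm b]

theorem rescale_mul_smallQExp (hb : constantCoeff b = 0) (c : ℤ⟦X⟧) :
    rescale (c * b) (smallQExp b) = (1 - C c * X) * rescale c (smallQExp b) := by
  rw [mul_comm c, ← rescale_rescale, rescale_smallQExp hb, map_mul, map_sub, map_one, rescale_X]

theorem bigQExp_eq_mul_rescale_cube (hb : constantCoeff b = 0) :
    bigQExp b = bigQExp (b ^ 3) * rescale b (bigQExp (b ^ 3)) *
      rescale (b ^ 2) (bigQExp (b ^ 3)) := by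
  have hcube := bigQExp_eq_mul_rescale (b := b ^ 3) (by simp [hb])
  refine eq_of_mul_rescale_eq (pow_succ_ne_one hb) (u := 1 + X) (v := 1) (by simp) (by simp) ?_ ?_
    (by simp)
  · rw [one_mul, ← bigQExp_eq_mul_rescale hb]
  · simp only [map_mul, rescale_rescale, ← sq, ← pow_succ]
    linear_combination -(rescale b (bigQExp (b ^ 3)) * rescale (b ^ 2) (bigQExp (b ^ 3))) * hcube

end QExponential

section TriangularSum

variable {b : ℤ⟦X⟧}

theorem coeff_pow_choose_two_mul_eq_zero (hb : constantCoeff b = 0) {d n : ℕ} (hn : d + 2 ≤ n)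
    (r : ℤ⟦X⟧) : coeff d (b ^ n.choose 2 * r) = 0 := by
  obtain ⟨m, rfl⟩ := Nat.exists_eq_add_of_le' hn
  have hle : d + 1 ≤ (m + (d + 2)).choose 2 := by
    rw [← add_assoc, Nat.choose_succ_succ' (m + d + 1) 1, Nat.choose_one_right]
    omega
  have hdvd : X ^ (m + (d + 2)).choose 2 ∣ b ^ (m + (d + 2)).choose 2 * r :=
    (pow_dvd_pow_of_dvd (X_dvd_iff.mpr hb) _).mul_right r
  exact X_pow_dvd_iff.mp hdvd d hle

theorem summable_pow_choose_two_mul (hb : constantCoeff b = 0) (r : ℕ → ℤ⟦X⟧) :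
    Summable fun n => b ^ n.choose 2 * r n := by
  refine WithPiTopology.summable_iff_summable_coeff _ |>.mpr fun d => ?_
  refine summable_of_ne_finset_zero (s := Finset.range (d + 2)) fun n hn => ?_
  exact coeff_pow_choose_two_mul_eq_zero hb (by simpa using hn) (r n)

theorem continuous_tsum_pow_choose_two_mul (hb : constantCoeff b = 0) :
    Continuous fun F : ℤ⟦X⟧⟦X⟧ => ∑' n, b ^ n.choose 2 * coeff n F := by
  refine continuous_iff_continuousAt.mpr fun F => ?_
  rw [ContinuousAt, WithPiTopology.tendsto_iff_coeff_tendsto]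
  intro d
  have hcoeff (G : ℤ⟦X⟧⟦X⟧) : coeff d (∑' n, b ^ n.choose 2 * coeff n G) =
      ∑ n ∈ Finset.range (d + 2), coeff d (b ^ n.choose 2 * coeff n G) := by
    rw [(summable_pow_choose_two_mul hb _).map_tsum (coeff d) (WithPiTopology.continuous_coeff ℤ d)]
    exact tsum_eq_sum fun n hn => coeff_pow_choose_two_mul_eq_zero hb (by simpa using hn) _
  simp only [hcoeff]
  have hcont (n : ℕ) : Continuous fun G : ℤ⟦X⟧⟦X⟧ => coeff d (b ^ n.choose 2 * coeff n G) :=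
    (WithPiTopology.continuous_coeff ℤ d).comp
      (continuous_const.mul (WithPiTopology.continuous_coeff ℤ⟦X⟧ n))
  exact (continuous_finsetSum _ fun n _ => hcont n).continuousAt

/-- The functional `L(∑ aₙ zⁿ) = ∑ b ^ (n (n - 1) / 2) aₙ` on power series in the outer variable
`z`. It exchanges multiplication by `z` and the substitution `z ↦ b z`, see
`triangularSum_X_mul`. -/
noncomputable def triangularSum (hb : constantCoeff b = 0) : ℤ⟦X⟧⟦X⟧ →ₜ+ ℤ⟦X⟧ where
  toFun F := ∑' n, b ^ n.choose 2 * coeff n F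
  map_zero' := by simp
  map_add' F G := by
    simp only [map_add, mul_add]
    exact (summable_pow_choose_two_mul hb _).tsum_add (summable_pow_choose_two_mul hb _)
  continuous_toFun := continuous_tsum_pow_choose_two_mul hb

theorem hasSum_triangularSum (hb : constantCoeff b = 0) (F : ℤ⟦X⟧⟦X⟧) :
    HasSum (fun n => b ^ n.choose 2 * coeff n F) (triangularSum hb F) :=
  (summable_pow_choose_two_mul hb _).hasSum

theorem triangularSum_C_mul (hb : constantCoeff b = 0) (r : ℤ⟦X⟧) (F : ℤ⟦X⟧⟦X⟧) :
    triangularSum hb (C r * F) = r * triangularSum hb F := by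
  refine (hasSum_triangularSum hb _).unique ?_
  simpa only [coeff_C_mul, mul_left_comm r] using (hasSum_triangularSum hb F).mul_left r

theorem triangularSum_one (hb : constantCoeff b = 0) : triangularSum hb 1 = 1 := by
  refine (hasSum_triangularSum hb _).unique ?_
  convert hasSum_single 0 fun n hn => ?_ using 1
  · simp
  · rw [coeff_one, if_neg hn, mul_zero]

theorem triangularSum_X_mul (hb : constantCoeff b = 0) (F : ℤ⟦X⟧⟦X⟧) :
    triangularSum hb (X * F) = triangularSum hb (rescale b F) := by
  refine (hasSum_triangularSum hb _).unique ((hasSum_nat_add_iff' 1).mp ?_)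
  simpa [Nat.choose_succ_succ', pow_add, mul_assoc, mul_left_comm] using
    hasSum_triangularSum hb (rescale b F)

theorem triangularSum_X_pow_mul (hb : constantCoeff b = 0) (n : ℕ) (F : ℤ⟦X⟧⟦X⟧) :
    triangularSum hb (X ^ n * F) = b ^ n.choose 2 * triangularSum hb (rescale (b ^ n) F) := by
  induction n generalizing F with
  | zero => simp
  | succ n ih =>
    rw [pow_succ, mul_assoc, ih, map_mul, rescale_X, mul_assoc, triangularSum_C_mul,
      triangularSum_X_mul, rescale_rescale, ← pow_succ, Nat.choose_succ_succ' n 1,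
      Nat.choose_one_right]
    ring

theorem triangularSum_monomial_mul (hb : constantCoeff b = 0) (n : ℕ) (r : ℤ⟦X⟧)
    (F : ℤ⟦X⟧⟦X⟧) : triangularSum hb (monomial n r * F) =
      b ^ n.choose 2 * r * triangularSum hb (rescale (b ^ n) F) := by
  have h : monomial n r = C r * X ^ n := by
    ext m
    rw [coeff_monomial, coeff_C_mul_X_pow]
  rw [h, mul_assoc, triangularSum_C_mul, triangularSum_X_pow_mul, mul_left_comm, mul_assoc]

theorem triangularSum_monomial (hb : constantCoeff b = 0) (n : ℕ) (r : ℤ⟦X⟧) :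
    triangularSum hb (monomial n r) = b ^ n.choose 2 * r := by
  simpa [triangularSum_one] using triangularSum_monomial_mul hb n r 1

theorem hasSum_triangularSum_of_monomial (hb : constantCoeff b = 0) {ι : Type*} {w : ι → ℕ}
    {r : ι → ℤ⟦X⟧} {F : ℤ⟦X⟧⟦X⟧} (hF : HasSum (fun p => monomial (w p) (r p)) F) :
    HasSum (fun p => b ^ (w p).choose 2 * r p) (triangularSum hb F) := by
  simpa only [Function.comp_def, triangularSum_monomial] using
    hF.map (triangularSum hb) (map_continuous _)

theorem triangularSum_rescale_smallQExp_eq_mul (hb : constantCoeff b = 0) (c : ℤ⟦X⟧) :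
    triangularSum hb (rescale c (smallQExp b)) =
      (1 + c) * triangularSum hb (rescale (c * b) (smallQExp b)) := by
  have hsplit : rescale c (smallQExp b) =
      rescale (c * b) (smallQExp b) + C c * (X * rescale c (smallQExp b)) := by
    rw [rescale_mul_smallQExp hb]
    ring
  conv_lhs => rw [hsplit]
  rw [map_add, triangularSum_C_mul, triangularSum_X_mul, rescale_rescale]
  ring

theorem triangularSum_rescale_smallQExp (hb : constantCoeff b = 0) (c : ℤ⟦X⟧) :
    triangularSum hb (rescale c (smallQExp b)) = qPochInf (-c) b := by
  have hiter (n : ℕ) : triangularSum hb (rescale c (smallQExp b)) =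
      qPoch (-c) b n * triangularSum hb (rescale (b ^ n) (rescale c (smallQExp b))) := by
    induction n with
    | zero => simp [qPoch]
    | succ n ih =>
      rw [ih, rescale_rescale, triangularSum_rescale_smallQExp_eq_mul, qPoch_succ, rescale_rescale]
      ring_nf
  have hlim := (tendsto_qPoch hb (-c)).mul (((map_continuous (triangularSum hb)).tendsto _).comp
    (tendsto_rescale_pow (WithPiTopology.isTopologicallyNilpotent_of_constantCoeff_zero hb)
      (rescale c (smallQExp b))))
  simp only [Function.comp_def, ← hiter, constantCoeff_rescale, constantCoeff_smallQExp, map_one,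
    triangularSum_one, mul_one] at hlim
  exact tendsto_nhds_unique tendsto_const_nhds hlim

theorem hasSum_coeff_rescale_bigQExp (hb : constantCoeff b = 0) (c : ℤ⟦X⟧) :
    HasSum (fun n => coeff n (rescale c (bigQExp b))) (qPochInf (-c) b) := by
  rw [← triangularSum_rescale_smallQExp hb]
  convert hasSum_triangularSum hb (rescale c (smallQExp b)) using 2 with n
  rw [coeff_rescale_smallQExp, coeff_rescale_bigQExp, mul_psDiv, mul_comm]

end TriangularSum

section Recurrence

variable {R : Type*} [CommRing R] {c d α β : R} {F : R⟦X⟧}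

theorem rescale_add_mul_eq_sub_mul
    (hF : (1 + C α * X) * (1 + C β * X) * rescale c F = (1 - C d * X ^ 2) * F) :
    rescale c F + C α * (X * rescale c F) + C β * (X * rescale c F) +
      C (α * β) * (X ^ 2 * rescale c F) = F - C d * (X ^ 2 * F) := by
  rw [map_mul]
  linear_combination hF

theorem one_sub_mul_coeff_one_of_mul_rescale_eq
    (hF : (1 + C α * X) * (1 + C β * X) * rescale c F = (1 - C d * X ^ 2) * F) :
    (1 - c) * coeff 1 F = (α + β) * constantCoeff F := by
  have h := congrArg (coeff 1) (rescale_add_mul_eq_sub_mul hF)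
  simp only [map_add, map_sub, coeff_C_mul, coeff_X_pow_mul', coeff_succ_X_mul, coeff_rescale,
    show ¬2 ≤ 1 by lia, if_false, coeff_zero_eq_constantCoeff_apply] at h
  linear_combination -h

theorem one_sub_mul_coeff_add_two_of_mul_rescale_eq
    (hF : (1 + C α * X) * (1 + C β * X) * rescale c F = (1 - C d * X ^ 2) * F) (n : ℕ) :
    (1 - c ^ (n + 2)) * coeff (n + 2) F =
      (α + β) * c ^ (n + 1) * coeff (n + 1) F + (α * β * c ^ n + d) * coeff n F := by
  have h := congrArg (coeff (n + 2)) (rescale_add_mul_eq_sub_mul hF)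
  simp only [map_add, map_sub, coeff_C_mul, coeff_X_pow_mul, coeff_succ_X_mul, coeff_rescale] at h
  linear_combination -h

end Recurrence

section TwoBaseSeries

/-- The series `(-α z; b)_∞ (-β z; b)_∞ / (b z²; b²)_∞` in the outer variable `z`. When `α β = b²`,
its coefficients are explicit multiples of those of the series `(-α z; b²)_∞ (-β z; b²)_∞` over the
base `b²`, see `pow_choose_two_mul_coeff_twoBaseSeries`. -/
noncomputable def twoBaseSeries (b α β : ℤ⟦X⟧) : ℤ⟦X⟧⟦X⟧ :=
  rescale α (bigQExp b) * rescale β (bigQExp b) *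
    expand 2 two_ne_zero (rescale b (smallQExp (b ^ 2)))

variable {b α β : ℤ⟦X⟧}

@[simp]
theorem constantCoeff_twoBaseSeries (b α β : ℤ⟦X⟧) : constantCoeff (twoBaseSeries b α β) = 1 := by
  simp [twoBaseSeries]

theorem mul_rescale_twoBaseSeries (hb : constantCoeff b = 0) (α β : ℤ⟦X⟧) :
    (1 + C α * X) * (1 + C β * X) * rescale b (twoBaseSeries b α β) =
      (1 - C b * X ^ 2) * twoBaseSeries b α β := by
  have hdenom : rescale b (expand 2 two_ne_zero (rescale b (smallQExp (b ^ 2)))) =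
      (1 - C b * X ^ 2) * expand 2 two_ne_zero (rescale b (smallQExp (b ^ 2))) := by
    rw [rescale_expand, rescale_rescale, rescale_mul_smallQExp (by simp [hb])]
    simp only [map_mul, map_sub, map_one, expand_C, expand_X]
  simp only [twoBaseSeries, map_mul (rescale b), rescale_rescale, hdenom]
  rw [rescale_bigQExp hb α, rescale_bigQExp hb β]
  ring

theorem mul_rescale_bigQExp_sq (hb : constantCoeff b = 0) (α β : ℤ⟦X⟧) :
    (1 + C α * X) * (1 + C β * X) *
        rescale (b ^ 2) (rescale α (bigQExp (b ^ 2)) * rescale β (bigQExp (b ^ 2))) =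
      rescale α (bigQExp (b ^ 2)) * rescale β (bigQExp (b ^ 2)) := by
  have hb2 : constantCoeff (b ^ 2) = 0 := by simp [hb]
  rw [map_mul, rescale_rescale, rescale_rescale, rescale_bigQExp hb2 α, rescale_bigQExp hb2 β]
  ring

theorem pow_choose_two_mul_coeff_twoBaseSeries (hb : constantCoeff b = 0) (hαβ : α * β = b ^ 2)
    (n : ℕ) : b ^ n.choose 2 * coeff n (twoBaseSeries b α β) =
      qPoch (-b) b n * coeff n (rescale α (bigQExp (b ^ 2)) * rescale β (bigQExp (b ^ 2))) := by
  have hW := mul_rescale_twoBaseSeries hb α β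
  have hE := (mul_rescale_bigQExp_sq hb α β).trans
    (show _ = (1 - C 0 * X ^ 2) * _ by rw [map_zero, zero_mul, sub_zero, one_mul])
  have hchoose (n : ℕ) : (n + 1).choose 2 = n.choose 2 + n := by
    rw [Nat.choose_succ_succ' n 1, Nat.choose_one_right, add_comm]
  induction n using Nat.twoStepInduction with
  | zero => simp [qPoch]
  | one =>
    have h₁ := one_sub_mul_coeff_one_of_mul_rescale_eq hW
    have h₂ := one_sub_mul_coeff_one_of_mul_rescale_eq hE
    rw [constantCoeff_twoBaseSeries] at h₁
    rw [map_mul constantCoeff, constantCoeff_rescale, constantCoeff_rescale,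
      constantCoeff_bigQExp] at h₂
    refine mul_left_cancel₀ (sub_ne_zero.mpr (pow_succ_ne_one hb 0).symm) ?_
    rw [qPoch_succ, qPoch, Finset.prod_range_zero, hchoose 0, Nat.choose_zero_succ]
    linear_combination h₁ - h₂
  | more n ih₁ ih₂ =>
    have h₁ := one_sub_mul_coeff_add_two_of_mul_rescale_eq hW n
    have h₂ := one_sub_mul_coeff_add_two_of_mul_rescale_eq hE n
    rw [hαβ] at h₁ h₂
    refine mul_left_cancel₀ (sub_ne_zero.mpr (pow_succ_ne_one hb (n + 1)).symm) ?_
    rw [hchoose n, qPoch_succ] at ih₂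
    rw [hchoose (n + 1), hchoose n, qPoch_succ, qPoch_succ]
    linear_combination b ^ (n.choose 2 + n + (n + 1)) * h₁ + (α + β) * b ^ (2 * n + 2) * ih₂ +
      b ^ (2 * n + 2) * (1 + b ^ (n + 1)) * ih₁ -
      qPoch (-b) b n * (1 + b ^ (n + 1)) * h₂

theorem triangularSum_smallQExp_mul_twoBaseSeries (hb : constantCoeff b = 0)
    (hαβ : α * β = b ^ 2) :
    triangularSum hb (rescale b (smallQExp b) * twoBaseSeries b α β) =
      qPochInf (-b) b * (qPochInf (-α) (b ^ 2) * qPochInf (-β) (b ^ 2)) := by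
  have hb2 : constantCoeff (b ^ 2) = 0 := by simp [hb]
  have hterm (n : ℕ) : triangularSum hb
      (rescale b (smallQExp b) * monomial n (coeff n (twoBaseSeries b α β))) =
      qPochInf (-b) b *
        coeff n (rescale α (bigQExp (b ^ 2)) * rescale β (bigQExp (b ^ 2))) := by
    rw [mul_comm, triangularSum_monomial_mul, rescale_rescale, triangularSum_rescale_smallQExp,
      pow_choose_two_mul_coeff_twoBaseSeries hb hαβ, qPochInf_eq_qPoch_mul hb (-b) n, neg_mul]
    ring
  have hleft := ((hasSum_of_monomials_self (twoBaseSeries b α β)).mul_left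
    (rescale b (smallQExp b))).map (triangularSum hb) (map_continuous _)
  have hright := (hasSum_coeff_mul (hasSum_coeff_rescale_bigQExp hb2 α)
    (hasSum_coeff_rescale_bigQExp hb2 β)).mul_left (qPochInf (-b) b)
  simp only [Function.comp_def, hterm] at hleft
  exact hleft.unique hright

end TwoBaseSeries

section ProductSide

variable {q : ℤ⟦X⟧}

theorem qPochInf_neg_self_mul (hq : constantCoeff q = 0) :
    qPochInf (-q) q * qPochInf q (q ^ 2) = 1 := by
  have hq2 : constantCoeff (q ^ 2) = 0 := by simp [hq]
  refine (isUnit_qPochInf (q ^ 2) (q ^ 2) hq2 hq2).mul_right_cancel ?_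
  have h := qPochInf_neg_mul hq q
  rw [← sq] at h
  rw [mul_assoc, h, one_mul]

theorem qPochInf_neg_mul_qPochInf_neg (hq : constantCoeff q = 0) :
    qPochInf (-q ^ 2) (q ^ 6) * qPochInf (-q ^ 4) (q ^ 6) *
      (qPochInf (q ^ 2) (q ^ 12) * qPochInf (q ^ 10) (q ^ 12)) = 1 := by
  have hpow (n : ℕ) (hn : n ≠ 0) : constantCoeff (q ^ n) = 0 := by simp [hq, hn]
  have h₂ := qPochInf_neg_mul (hpow 6 (by lia)) (q ^ 2)
  have h₄ := qPochInf_neg_mul (hpow 6 (by lia)) (q ^ 4)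
  simp only [← pow_mul, ← pow_add, Nat.reduceMul, Nat.reduceAdd] at h₂ h₄
  refine ((isUnit_qPochInf (q ^ 4) (q ^ 12) (hpow 4 (by lia)) (hpow 12 (by lia))).mul
    (isUnit_qPochInf (q ^ 8) (q ^ 12) (hpow 8 (by lia)) (hpow 12 (by lia)))).mul_right_cancel ?_
  linear_combination qPochInf (-q ^ 4) (q ^ 6) * qPochInf (q ^ 4) (q ^ 12) *
    qPochInf (q ^ 10) (q ^ 12) * h₂ + qPochInf (q ^ 4) (q ^ 12) * h₄

theorem qPochInf_neg_mul_eq_psDiv (hq : constantCoeff q = 0) :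
    qPochInf (-q ^ 3) (q ^ 3) * (qPochInf (-q ^ 2) (q ^ 6) * qPochInf (-q ^ 4) (q ^ 6)) =
      psDiv 1 (qPochInfList [q ^ 2, q ^ 3, q ^ 9, q ^ 10] (q ^ 12)) := by
  have hcube := qPochInf_neg_self_mul (q := q ^ 3) (by simp [hq])
  have hsplit := qPochInf_mul_qPochInf_sq (q := q ^ 6) (by simp [hq]) (q ^ 3)
  simp only [← pow_mul, ← pow_add, Nat.reduceMul, Nat.reduceAdd] at hcube hsplit
  have hlist : qPochInfList [q ^ 2, q ^ 3, q ^ 9, q ^ 10] (q ^ 12) =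
      qPochInf (q ^ 3) (q ^ 6) * (qPochInf (q ^ 2) (q ^ 12) * qPochInf (q ^ 10) (q ^ 12)) := by
    simp only [qPochInfList, List.map_cons, List.map_nil, List.prod_cons, List.prod_nil, ← hsplit]
    ring
  have hunit := isUnit_qPochInfList [q ^ 2, q ^ 3, q ^ 9, q ^ 10] (q ^ 12) (by simp [hq])
    (by simp [hq])
  refine (Ring.eq_mul_inverse_iff_mul_eq _ _ _ hunit).mpr ?_
  rw [hlist, mul_mul_mul_comm, hcube, qPochInf_neg_mul_qPochInf_neg hq, one_mul]

theorem qPochInf_neg_mul_eq_qPochInfList (hq : constantCoeff q = 0) :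
    qPochInf (-q ^ 3) (q ^ 3) * (qPochInf (-q ^ 5) (q ^ 6) * qPochInf (-q) (q ^ 6)) =
      qPochInfList [-q, -q ^ 3, -q ^ 5, -q ^ 6] (q ^ 6) := by
  have hsplit := qPochInf_mul_qPochInf_sq (q := q ^ 3) (by simp [hq]) (-q ^ 3)
  rw [← pow_mul, neg_mul, ← pow_add] at hsplit
  simp only [qPochInfList, List.map_cons, List.map_nil, List.prod_cons, List.prod_nil, ← hsplit]
  ring

end ProductSide

section SumSide

theorem rescale_bigQExp_mul_expand_smallQExp {b : ℤ⟦X⟧} (hb : constantCoeff b = 0) :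
    rescale b (bigQExp b) * expand 2 two_ne_zero (rescale b (smallQExp b)) =
      rescale b (smallQExp b) * expand 2 two_ne_zero (rescale b (smallQExp (b ^ 2))) := by
  have hb2 : constantCoeff (b ^ 2) = 0 := by simp [hb]
  refine eq_of_mul_rescale_eq (pow_succ_ne_one hb) (u := 1 + C b * X)
    (v := (1 - C b * X ^ 2) * (1 - C (b ^ 2) * X ^ 2)) (by simp) (by simp) ?_ ?_ (by simp)
  · have hsmall : rescale (b * b ^ 2) (smallQExp b) =
        (1 - C b * X) * (1 - C (b ^ 2) * X) * rescale b (smallQExp b) := by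
      rw [← pow_succ', pow_succ, rescale_mul_smallQExp hb, sq, rescale_mul_smallQExp hb]
      ring
    rw [map_mul, rescale_expand, rescale_rescale, rescale_rescale, hsmall, rescale_bigQExp hb b]
    simp only [map_mul, map_sub, map_one, expand_C, expand_X]
    ring
  · rw [map_mul, rescale_expand, rescale_rescale, rescale_rescale, rescale_mul_smallQExp hb,
      rescale_mul_smallQExp hb2]
    simp only [map_mul, map_sub, map_one, expand_C, expand_X, map_pow]
    ring

/-- The series `(-q ^ (r + 2) z; q)_∞ / (q ^ (s + 3) z²; q³)_∞` in the outer variable `z`. Under the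
functional `triangularSum` with base `q³` it becomes the double sum with exponent
`2 i² + 6 i j + 6 j² + r i + s j`. -/
noncomputable def doubleSeries (q : ℤ⟦X⟧) (r s : ℕ) : ℤ⟦X⟧⟦X⟧ :=
  rescale (q ^ (r + 2)) (bigQExp q) *
    expand 2 two_ne_zero (rescale (q ^ (s + 3)) (smallQExp (q ^ 3)))

variable {q : ℤ⟦X⟧}

theorem rescale_doubleSeries (q : ℤ⟦X⟧) (r s : ℕ) :
    rescale (q ^ 3) (doubleSeries q r s) = doubleSeries q (r + 3) (s + 6) := by
  rw [doubleSeries, map_mul, rescale_expand, rescale_rescale, rescale_rescale, doubleSeries]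
  ring_nf

theorem rescale_bigQExp_eq_cube (hq : constantCoeff q = 0) (n : ℕ) :
    rescale (q ^ n) (bigQExp q) = rescale (q ^ n) (bigQExp (q ^ 3)) *
      rescale (q ^ (n + 1)) (bigQExp (q ^ 3)) * rescale (q ^ (n + 2)) (bigQExp (q ^ 3)) := by
  rw [bigQExp_eq_mul_rescale_cube hq]
  simp only [map_mul, rescale_rescale, ← pow_succ', ← pow_add, add_comm]

theorem doubleSeries_zero_zero (hq : constantCoeff q = 0) :
    doubleSeries q 0 0 =
      rescale (q ^ 3) (smallQExp (q ^ 3)) * twoBaseSeries (q ^ 3) (q ^ 2) (q ^ 4) := by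
  have h := rescale_bigQExp_mul_expand_smallQExp (b := q ^ 3) (by simp [hq])
  rw [doubleSeries, twoBaseSeries, rescale_bigQExp_eq_cube hq]
  linear_combination rescale (q ^ 2) (bigQExp (q ^ 3)) * rescale (q ^ 4) (bigQExp (q ^ 3)) * h

theorem one_add_mul_doubleSeries_one_zero (hq : constantCoeff q = 0) :
    (1 + C q * X) * doubleSeries q 1 0 =
      rescale (q ^ 3) (smallQExp (q ^ 3)) * twoBaseSeries (q ^ 3) (q ^ 5) q := by
  have h := rescale_bigQExp_mul_expand_smallQExp (b := q ^ 3) (by simp [hq])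
  rw [doubleSeries, twoBaseSeries, rescale_bigQExp_eq_cube hq,
    rescale_bigQExp (by simp [hq]) q, ← pow_succ']
  linear_combination (1 + C q * X) * rescale (q ^ 4) (bigQExp (q ^ 3)) *
    rescale (q ^ 5) (bigQExp (q ^ 3)) * h

theorem sq_eq_two_mul_choose_two_add (n : ℕ) : n ^ 2 = 2 * n.choose 2 + n := by
  rw [Nat.choose_two_right, Nat.mul_div_cancel' (Nat.even_mul_pred_self n).two_dvd, sq]
  cases n <;> simp [mul_add]

theorem three_mul_choose_two_add (i j : ℕ) :
    3 * (i + 2 * j).choose 2 + i.choose 2 + 2 * i + 3 * j =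
      2 * i ^ 2 + 6 * i * j + 6 * j ^ 2 := by
  have h := sq_eq_two_mul_choose_two_add (i + 2 * j)
  have hi := sq_eq_two_mul_choose_two_add i
  nlinarith

theorem hasSum_doubleSeries (hq3 : constantCoeff (q ^ 3) = 0) (r s : ℕ) :
    HasSum (fun p : ℕ × ℕ =>
        psDiv (q ^ (2 * p.1 ^ 2 + 6 * p.1 * p.2 + 6 * p.2 ^ 2 + r * p.1 + s * p.2))
          (qPoch q q p.1 * qPoch (q ^ 3) (q ^ 3) p.2))
      (triangularSum hq3 (doubleSeries q r s)) := by
  rw [doubleSeries]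
  convert hasSum_triangularSum_of_monomial hq3 (hasSum_monomial_mul
    (hasSum_of_monomials_self (rescale (q ^ (r + 2)) (bigQExp q)))
    (hasSum_monomial_expand two_ne_zero (rescale (q ^ (s + 3)) (smallQExp (q ^ 3))))) using 2
    with p
  simp only [coeff_rescale_bigQExp, coeff_rescale_smallQExp, psDiv_mul_psDiv]
  rw [mul_psDiv, ← three_mul_choose_two_add]
  ring_nf

theorem hasSum_cap1Term (h3 : constantCoeff (X ^ 3 : ℤ⟦X⟧) = 0) :
    HasSum cap1Term (triangularSum h3 (doubleSeries X 0 0)) := by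
  convert hasSum_doubleSeries h3 0 0 using 2 with p
  rw [cap1Term, zero_mul, zero_mul, add_zero, add_zero]

theorem hasSum_cap2TermA (h3 : constantCoeff (X ^ 3 : ℤ⟦X⟧) = 0) :
    HasSum cap2TermA (triangularSum h3 (doubleSeries X 1 0)) := by
  convert hasSum_doubleSeries h3 1 0 using 2 with p
  rw [cap2TermA, one_mul, zero_mul, add_zero]

theorem hasSum_cap2TermB (h3 : constantCoeff (X ^ 3 : ℤ⟦X⟧) = 0) :
    HasSum cap2TermB (X * triangularSum h3 (doubleSeries X 4 6)) := by
  have h := (hasSum_doubleSeries h3 4 6).mul_left X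
  simp only [mul_psDiv, ← pow_succ'] at h
  exact h

theorem cap2Exponent_eq (i j k l : ℕ) :
    cap2Exponent i j k l =
      3 * (i + (j + (k + 2 * l))).choose 2 +
        (3 * i + (5 * j + 3 * j.choose 2 + (k + 3 * k.choose 2 + 3 * l))) := by
  have h (n : ℕ) : 3 * n * (n - 1) / 2 = 3 * n.choose 2 := by
    rw [Nat.choose_two_right, mul_assoc, Nat.mul_div_assoc _ (Nat.even_mul_pred_self n).two_dvd]
  rw [cap2Exponent, h, h, h]
  ring_nf

theorem hasSum_cap2TermFour (h3 : constantCoeff (X ^ 3 : ℤ⟦X⟧) = 0) :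
    HasSum cap2TermFour (triangularSum h3
      (rescale (X ^ 3) (smallQExp (X ^ 3)) * twoBaseSeries (X ^ 3) (X ^ 5) X)) := by
  rw [twoBaseSeries, mul_assoc (rescale _ _)]
  convert hasSum_triangularSum_of_monomial h3 (hasSum_monomial_mul
    (hasSum_of_monomials_self (rescale (X ^ 3) (smallQExp (X ^ 3))))
    (hasSum_monomial_mul
      (hasSum_of_monomials_self (rescale (X ^ 5) (bigQExp (X ^ 3))))
      (hasSum_monomial_mul
        (hasSum_of_monomials_self (rescale X (bigQExp (X ^ 3))))
        (hasSum_monomial_expand two_ne_zero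
          (rescale (X ^ 3) (smallQExp ((X ^ 3) ^ 2))))))) using 2 with p
  simp only [coeff_rescale_bigQExp, coeff_rescale_smallQExp, psDiv_mul_psDiv]
  rw [mul_psDiv, cap2TermFour, cap2Exponent_eq]
  simp only [← pow_mul, ← pow_add, Nat.reduceMul, mul_assoc]

theorem triangularSum_doubleSeries_zero_zero (hq : constantCoeff q = 0)
    (hq3 : constantCoeff (q ^ 3) = 0) :
    triangularSum hq3 (doubleSeries q 0 0) =
      psDiv 1 (qPochInfList [q ^ 2, q ^ 3, q ^ 9, q ^ 10] (q ^ 12)) := by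
  rw [doubleSeries_zero_zero hq, triangularSum_smallQExp_mul_twoBaseSeries hq3 (by ring), ← pow_mul,
    qPochInf_neg_mul_eq_psDiv hq]

theorem triangularSum_smallQExp_mul_twoBaseSeries_eq_qPochInfList (hq : constantCoeff q = 0)
    (hq3 : constantCoeff (q ^ 3) = 0) :
    triangularSum hq3 (rescale (q ^ 3) (smallQExp (q ^ 3)) * twoBaseSeries (q ^ 3) (q ^ 5) q) =
      qPochInfList [-q, -q ^ 3, -q ^ 5, -q ^ 6] (q ^ 6) := by
  rw [triangularSum_smallQExp_mul_twoBaseSeries hq3 (by ring), ← pow_mul,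
    qPochInf_neg_mul_eq_qPochInfList hq]

theorem triangularSum_doubleSeries_add (hq : constantCoeff q = 0)
    (hq3 : constantCoeff (q ^ 3) = 0) :
    triangularSum hq3 (doubleSeries q 1 0) + q * triangularSum hq3 (doubleSeries q 4 6) =
      triangularSum hq3
        (rescale (q ^ 3) (smallQExp (q ^ 3)) * twoBaseSeries (q ^ 3) (q ^ 5) q) := by
  rw [← one_add_mul_doubleSeries_one_zero hq, add_mul, one_mul, map_add, mul_assoc,
    triangularSum_C_mul, triangularSum_X_mul, rescale_doubleSeries]

end SumSide

theorem mainTheorem1 :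
    (Summable cap1Term ∧
      ∑' p, cap1Term p = psDiv 1 (qPochInfList [X ^ 2, X ^ 3, X ^ 9, X ^ 10] (X ^ 12))) ∧
    (Summable cap2TermFour ∧ Summable cap2TermA ∧ Summable cap2TermB ∧
      (∑' p, cap2TermFour p) = (∑' p, cap2TermA p) + (∑' p, cap2TermB p) ∧
      (∑' p, cap2TermA p) + (∑' p, cap2TermB p) =
        qPochInfList [-X, -X ^ 3, -X ^ 5, -X ^ 6] (X ^ 6)) := by
  have h3 : constantCoeff (X ^ 3 : ℤ⟦X⟧) = 0 := by simp
  have h1 := hasSum_cap1Term h3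
  have hA := hasSum_cap2TermA h3
  have hB := hasSum_cap2TermB h3
  have hFour := hasSum_cap2TermFour h3
  refine ⟨⟨h1.summable, ?_⟩, hFour.summable, hA.summable, hB.summable, ?_, ?_⟩
  · rw [h1.tsum_eq, triangularSum_doubleSeries_zero_zero constantCoeff_X]
  · rw [hFour.tsum_eq, hA.tsum_eq, hB.tsum_eq, triangularSum_doubleSeries_add constantCoeff_X]
  · rw [hA.tsum_eq, hB.tsum_eq, triangularSum_doubleSeries_add constantCoeff_X,
      triangularSum_smallQExp_mul_twoBaseSeries_eq_qPochInfList constantCoeff_X]
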